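/- Let $n_1,n_2,m_1,m_2\ge 0$ and $n_3\ge 1$ be integers, $n:=n_1+n_2+n_3$, and let $A\in\mathbb Z^{m_1\times n_1}$, $B\in\mathbb Z^{m_2\times n_2}$, $C\in\mathbb Z^{m_1\times n_3}$, $D\in\mathbb Z^{m_2\times n_3}$, $a\in\mathbb Z^{m_1}$, $b\in\mathbb Z^{m_2}$ with $C\ge 0$ and $D\le 0$ entrywise. Consider the system $$(1)\qquad Ax+Cz\le a,\quad By+Dz\le b,\quad x\in\{0,1\}^{n_1},\ y\in\{0,1\}^{n_2},\ z\in\{0,1\}^{n_3}.$$ A branch-and-bound tree $T$ for (1) is a finite rooted binary tree in which every inner node carries a general disjunction $\alpha^\top w\le\delta\ \lor\ \alpha^\top w\ge\delta+1$ in the variables $w=(x,y,z)$, with $\alpha\in\mathbb Z^n$ and $\delta\in\mathbb Z$, its left outgoing edge being labeled $\alpha^\top w\le\delta$ and its right one $\alpha^\top w\ge\delta+1$, such that for every leaf the inequalities of the LP-relaxation of (1) (where $\{0,1\}$ is replaced by $[0,1]$) together with all edge labels on the path from the root to that leaf have no rational solution. Its size $|T|$ is its number of leaves. A monotone real circuit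 with input variables $z_1,\dots,z_{n_3}$ is a finite acyclic directed graph with a designated output gate, in which every gate either has fan-in zero and is labeled by a variable, or has two ordered incoming edges (possibly from the same gate) and applies a non-decreasing function $\mathbb R^2\to\mathbb R$. Its size is its number of gates, and $K(z)$ denotes the value computed at the output gate on input $z$. Let $$Z_1=\{z\in\{0,1\}^{n_3} : \exists x\in\{0,1\}^{n_1},\ Ax\le a-Cz\},\qquad Z_2=\{z\in\{0,1\}^{n_3} : \exists y\in\{0,1\}^{n_2},\ By\le b-Dz\}.$$ Theorem. General-disjunction branch-and-bound admits quasi-feasible monotone real interpolation. Precisely, for every branch-and-bound tree $T$ for (1) there is a monotone real circuit $K$ with input $z$, of size at most $$50\,(n+1)^2\,|T|^2\cdot\bigl[(n+2)^2\log_2(10n^3+3)\bigr]^{\log_2((4n+5)|T|)},$$ which separates $Z_1$ and $Z_2$, i.e. it takes the value $1$ on all of one of these two sets and the value $0$ on all of the other, and which computes an interpolant for (1), i.e. for every $z\in\{0,1\}^{n_3}$ we have $K(z)\in\{0,1\}$, $K(z)=1$ implies $z\notin Z_1$, and $K(z)=0$ implies $z\notin Z_2$. -/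

import Mathlib

/-! ### Linear inequalities and branch-and-bound trees -/

/-- A linear inequality `coeff ⬝ w ≤ rhs` with integral data in the variables indexed by `ι`. -/
@[ext] structure LinIneq (ι : Type) where
  coeff : ι → ℤ
  rhs : ℤ

/-- The rational point `w` satisfies the inequality `c`. -/
def LinIneq.Holds {ι : Type} [Fintype ι] (c : LinIneq ι) (w : ι → ℚ) : Prop :=
  ∑ j, (c.coeff j : ℚ) * w j ≤ (c.rhs : ℚ)

/-- A system of inequalities is LP-feasible if it has a rational solution.  (For a finite system
with integral data this is the same as having a real solution.) -/
def LPFeasible {ι : Type} [Fintype ι] (P : Set (LinIneq ι)) : Prop :=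
  ∃ w : ι → ℚ, ∀ c ∈ P, c.Holds w

/-- Rooted binary trees each of whose inner nodes carries a general disjunction
`α ⬝ w ≤ δ ∨ α ⬝ w ≥ δ + 1` with integral `α`, `δ`.  The first subtree is the `≤`-branch, the second
one the `≥`-branch. -/
inductive BBTree (ι : Type) : Type
  | leaf : BBTree ι
  | node (α : ι → ℤ) (δ : ℤ) (left right : BBTree ι) : BBTree ι

/-- The size of a branch-and-bound tree is its number of leaves. -/
def BBTree.size {ι : Type} : BBTree ι → ℕ
  | .leaf => 1
  | .node _ _ l r => l.size + r.size

/-- `T.IsProofFor P`: the tree `T` is a (valid) branch-and-bound tree for the system with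
LP-relaxation `P`, i.e. at every leaf the inequalities of `P` together with all edge labels on the
path from the root to that leaf form an LP-infeasible system.  The label `α ⬝ w ≥ δ + 1` is
written as `(-α) ⬝ w ≤ -(δ + 1)`. -/
def BBTree.IsProofFor {ι : Type} [Fintype ι] : BBTree ι → Set (LinIneq ι) → Prop
  | .leaf, P => ¬ LPFeasible P
  | .node α δ l r, P =>
      l.IsProofFor (insert ⟨α, δ⟩ P) ∧ r.IsProofFor (insert ⟨-α, -(δ + 1)⟩ P)

/-! ### The split system -/

/-- The variables `x`, `y`, `z` of the split system. -/
abbrev SplitVar (n₁ n₂ n₃ : ℕ) : Type := Fin n₁ ⊕ Fin n₂ ⊕ Fin n₃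

/-- The LP-relaxation of the split system
`A x + C z ≤ a`, `B y + D z ≤ b`, `x, y, z` binary:
the rows of the two blocks together with the bounds `w ≤ 1` and `-w ≤ 0` for every variable `w`. -/
def splitRelaxation {n₁ n₂ n₃ m₁ m₂ : ℕ}
    (A : Matrix (Fin m₁) (Fin n₁) ℤ) (B : Matrix (Fin m₂) (Fin n₂) ℤ)
    (C : Matrix (Fin m₁) (Fin n₃) ℤ) (D : Matrix (Fin m₂) (Fin n₃) ℤ)
    (a : Fin m₁ → ℤ) (b : Fin m₂ → ℤ) : Set (LinIneq (SplitVar n₁ n₂ n₃)) :=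
  Set.range (fun i : Fin m₁ => ⟨Sum.elim (A i) (Sum.elim 0 (C i)), a i⟩) ∪
  Set.range (fun i : Fin m₂ => ⟨Sum.elim 0 (Sum.elim (B i) (D i)), b i⟩) ∪
  Set.range (fun j : SplitVar n₁ n₂ n₃ => ⟨Pi.single j 1, 1⟩) ∪
  Set.range (fun j : SplitVar n₁ n₂ n₃ => ⟨-Pi.single j 1, 0⟩)

/-- All entries are `0` or `1`. -/
def IsBinary {ι : Type} (v : ι → ℤ) : Prop := ∀ i, v i = 0 ∨ v i = 1

/-- For an integral block `M u + N z ≤ c`, the set of all binary `z` for which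
`M u ≤ c - N z` has a binary solution `u`. -/
def feasibleSet {p q m : ℕ} (M : Matrix (Fin m) (Fin p) ℤ) (N : Matrix (Fin m) (Fin q) ℤ)
    (c : Fin m → ℤ) : Set (Fin q → ℤ) :=
  {z | IsBinary z ∧ ∃ u : Fin p → ℤ, IsBinary u ∧ M.mulVec u ≤ c - N.mulVec z}

/-- An integral vector, regarded as a real vector. -/
def toRealVec {ι : Type} (z : ι → ℤ) : ι → ℝ := fun j => (z j : ℝ)

/-! ### Monotone real circuits -/

/-- What stands at a gate: a variable (fan-in zero), or a non-decreasing function `ℝ² → ℝ` together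
with the ordered pair of predecessors (fan-in two; the two predecessors may coincide). -/
inductive GateLabel (V G : Type) : Type
  | input (v : V) : GateLabel V G
  | op (f : ℝ × ℝ →o ℝ) (g₁ g₂ : G) : GateLabel V G

/-- There is an edge from `g'` to `g`. -/
def GateEdge {V G : Type} (label : G → GateLabel V G) (g' g : G) : Prop :=
  ∃ f g₁ g₂, label g = .op f g₁ g₂ ∧ (g' = g₁ ∨ g' = g₂)

/-- A monotone real circuit with input variables `V`. -/
structure MonotoneRealCircuit (V : Type) where
  Gate : Type
  fintypeGate : Fintype Gate
  label : Gate → GateLabel V Gate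
  /-- There is no directed cycle. -/
  acyclic : ∀ g, ¬ Relation.TransGen (GateEdge label) g g
  output : Gate

namespace MonotoneRealCircuit

variable {V : Type}

/-- The size of a circuit is its number of gates (input gates included). -/
def size (K : MonotoneRealCircuit V) : ℕ := @Fintype.card K.Gate K.fintypeGate

theorem wellFounded_edge (K : MonotoneRealCircuit V) : WellFounded (GateEdge K.label) := by
  have := K.fintypeGate
  have : Std.Irrefl (Relation.TransGen (GateEdge K.label)) := ⟨K.acyclic⟩
  exact Subrelation.wf (fun h => Relation.TransGen.single h)
    (Finite.wellFounded_of_trans_of_irrefl (Relation.TransGen (GateEdge K.label)))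

/-- The value computed at a gate on input `x`. -/
noncomputable def gateValue (K : MonotoneRealCircuit V) (x : V → ℝ) : K.Gate → ℝ :=
  K.wellFounded_edge.fix fun g ih =>
    match h : K.label g with
    | .input v => x v
    | .op f g₁ g₂ =>
        f (ih g₁ ⟨f, g₁, g₂, h, Or.inl rfl⟩, ih g₂ ⟨f, g₁, g₂, h, Or.inr rfl⟩)

theorem gateValue_input (K : MonotoneRealCircuit V) (x : V → ℝ) {g : K.Gate} {v : V}
    (h : K.label g = .input v) : K.gateValue x g = x v := by
  rw [gateValue, WellFounded.fix_eq]
  split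
  · simp_all
  · simp_all

theorem gateValue_op (K : MonotoneRealCircuit V) (x : V → ℝ) {g g₁ g₂ : K.Gate}
    {f : ℝ × ℝ →o ℝ} (h : K.label g = .op f g₁ g₂) :
    K.gateValue x g = f (K.gateValue x g₁, K.gateValue x g₂) := by
  rw [gateValue, WellFounded.fix_eq]
  split
  · simp_all
  · rename_i h'
    rw [h] at h'
    cases h'
    rfl

/-- The value computed by the circuit on input `x`. -/
noncomputable def eval (K : MonotoneRealCircuit V) (x : V → ℝ) : ℝ := K.gateValue x K.output

/-- The circuit is constantly `1` on one of the two sets and constantly `0` on the other. -/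
def Separates (K : MonotoneRealCircuit V) (S₁ S₂ : Set (V → ℝ)) : Prop :=
  ((∀ x ∈ S₁, K.eval x = 1) ∧ (∀ x ∈ S₂, K.eval x = 0)) ∨
  ((∀ x ∈ S₁, K.eval x = 0) ∧ (∀ x ∈ S₂, K.eval x = 1))

/-- The circuit computes an interpolant: on every binary `z` its value is `0` or `1`, the value `1`
implies `z ∉ Z₁` (the system in `x` is infeasible for this `z`), and the value `0` implies
`z ∉ Z₂` (the system in `y` is infeasible for this `z`). -/
def ComputesInterpolant (K : MonotoneRealCircuit V) (Z₁ Z₂ : Set (V → ℤ)) : Prop :=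
  ∀ z : V → ℤ, IsBinary z →
    (K.eval (toRealVec z) = 0 ∨ K.eval (toRealVec z) = 1) ∧
    (K.eval (toRealVec z) = 1 → z ∉ Z₁) ∧
    (K.eval (toRealVec z) = 0 → z ∉ Z₂)

end MonotoneRealCircuit

/-- The bound `50 (n+1)² s² · [(n+2)² log₂(10 n³ + 3)] ^ log₂((4n+5) s)`. -/
noncomputable def interpolationBound (n s : ℕ) : ℝ :=
  50 * ((n : ℝ) + 1) ^ 2 * (s : ℝ) ^ 2 *
    (((n : ℝ) + 2) ^ 2 * Real.logb 2 (10 * (n : ℝ) ^ 3 + 3)) ^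
      (Real.logb 2 ((4 * (n : ℝ) + 5) * (s : ℝ)))

/-! Let `P` be the feasible pairs `(x, z)` of the first block and `Q` the feasible pairs `(y, z')`
of the second. A pair from `P × Q` is combined to the point `(x, y, z)`. The excess of any
inequality at this point is a function of `q` minus a function of `p`, so the pairs violating it
form a Ferrers relation. First-block rows and bounds are never violated; since `D ≤ 0`, a
second-block row is violated only if `z j < z' j` for some `j`.

Monotone real circuits can follow such relations: a gate bounded above by `f` on `P` and below by
`g` on `Q` represents `f p < g q`, and a Ferrers relation covered by two represented ones costs one
more gate (`FerrersDerivation.exists_circuit`). It therefore suffices to derive all of `P × Q` from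
the relations `z j < z' j`, in few covering steps.

At a leaf, Farkas' lemma gives a nonnegative combination with positive excess everywhere. Adding its
terms one at a time derives every pair, because a sum is positive only if a summand is
(`simulates_leaf`). At an inner node, by integrality, every pair violates exactly one of the two
labels. The smaller subtree handles the pairs satisfying its own label, that is, those violating the
other label; the larger subtree may then use that relation and runs once (`extends_node`). A subtree
can only be run on pairs on which two keys agree, whereas a violation is a strict comparison. Binary
search on the ranks of the compared values splits it into `L` such agreement relations
(`extends_lexRel_of_refinements`), so the smaller subtree runs `L` times. Since `L` is about `log₂
|P|`, the recursion `L * cost s + cost t` with `s ≤ t` is quasi-polynomial (`cost_node`). -/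

/-! ### Farkas' lemma over `ℚ` -/

/-- **Farkas' lemma** for finitely many linear functionals. -/
theorem exists_nonneg_combination_of_forall_nonpos {W J : Type} [AddCommGroup W] [Module ℚ W]
    (s : Finset J) (a : J → W →ₗ[ℚ] ℚ) (b : W →ₗ[ℚ] ℚ)
    (h : ∀ x, (∀ i ∈ s, a i x ≤ 0) → b x ≤ 0) :
    ∃ r : J → ℚ, (∀ i, 0 ≤ r i) ∧ ∀ x, b x = ∑ i ∈ s, r i * a i x := by
  classical
  induction s using Finset.induction_on generalizing a b with
  | empty =>
    refine ⟨0, fun _ => le_rfl, fun x => ?_⟩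
    have h1 := h x (by simp)
    have h2 := h (-x) (by simp)
    rw [map_neg] at h2
    simp only [Finset.sum_empty]
    linarith
  | insert k s hk ih =>
    by_cases hs : ∀ x, (∀ i ∈ s, a i x ≤ 0) → b x ≤ 0
    · obtain ⟨r, hr, hb⟩ := ih a b hs
      refine ⟨Function.update r k 0, fun i => ?_, fun x => ?_⟩
      · by_cases hi : i = k
        · simp [hi]
        · simp [hi, hr i]
      · rw [Finset.sum_insert hk, hb x, Function.update_self, zero_mul, zero_add]
        refine Finset.sum_congr rfl fun i hi => ?_
        rw [Function.update_of_ne (ne_of_mem_of_not_mem hi hk)]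
    · push Not at hs
      obtain ⟨x₀, hx₀, hbx₀⟩ := hs
      have hpos : 0 < a k x₀ := by
        by_contra hle
        refine hbx₀.not_ge (h x₀ fun i hi => ?_)
        rcases Finset.mem_insert.1 hi with rfl | hi
        · exact not_lt.1 hle
        · exact hx₀ i hi
      set t := a k x₀ with ht
      -- All functionals are corrected by multiples of `a k` so that they vanish at `x₀`; projecting
      -- along `x₀` onto the kernel of `a k` reduces to the hypothesis `h`.
      obtain ⟨r, hr, hb⟩ := ih (fun i => a i - (a i x₀ / t) • a k) (b - (b x₀ / t) • a k) (by
        intro x hx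
        have hy := h (x - (a k x / t) • x₀) (by
          intro i hi
          rcases Finset.mem_insert.1 hi with rfl | hi
          · simp only [map_sub, map_smul, smul_eq_mul, ← ht]
            rw [div_mul_cancel₀ _ hpos.ne', sub_self]
          · have := hx i hi
            simp only [LinearMap.sub_apply, LinearMap.smul_apply, map_sub, map_smul,
              smul_eq_mul] at this ⊢
            calc _ = _ := by ring
              _ ≤ 0 := this)
        simp only [LinearMap.sub_apply, LinearMap.smul_apply, map_sub, map_smul,
          smul_eq_mul] at hy ⊢
        calc _ = _ := by ring
          _ ≤ 0 := hy)
      refine ⟨Function.update r k (b x₀ / t - ∑ i ∈ s, r i * (a i x₀ / t)), fun i => ?_,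
        fun x => ?_⟩
      · by_cases hi : i = k
        · subst hi
          rw [Function.update_self, sub_nonneg]
          refine (Finset.sum_nonpos fun j hj => ?_).trans (div_pos hbx₀ hpos).le
          exact mul_nonpos_of_nonneg_of_nonpos (hr j)
            (div_nonpos_of_nonpos_of_nonneg (hx₀ j hj) hpos.le)
        · simp [hi, hr i]
      · have hb' := hb x
        simp only [LinearMap.sub_apply, LinearMap.smul_apply, smul_eq_mul, mul_sub,
          Finset.sum_sub_distrib] at hb'
        rw [Finset.sum_insert hk, Function.update_self, sub_mul, Finset.sum_mul]
        have : ∑ i ∈ s, Function.update r k (b x₀ / t - ∑ i ∈ s, r i * (a i x₀ / t)) i * a i x =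
            ∑ i ∈ s, r i * a i x := Finset.sum_congr rfl fun i hi => by
          rw [Function.update_of_ne (ne_of_mem_of_not_mem hi hk)]
        rw [this]
        have h3 : ∑ i ∈ s, r i * (a i x₀ / t * a k x) = ∑ i ∈ s, r i * (a i x₀ / t) * a k x :=
          Finset.sum_congr rfl fun i _ => by ring
        linarith

/-- The amount by which `w` violates the inequality `c`. -/
def LinIneq.excess {ι : Type} [Fintype ι] (c : LinIneq ι) (w : ι → ℚ) : ℚ :=
  ∑ j, (c.coeff j : ℚ) * w j - c.rhs

/-- An LP-infeasible finite system has a nonnegative combination of its inequalities that is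
violated by every point. -/
theorem exists_combination_excess_pos {ι : Type} [Fintype ι] (F : Finset (LinIneq ι))
    (h : ¬ LPFeasible (F : Set (LinIneq ι))) :
    ∃ r : LinIneq ι → ℚ, (∀ c, 0 ≤ r c) ∧ ∀ w, 0 < ∑ c ∈ F, r c * c.excess w := by
  classical
  -- Homogenization: the last coordinate scales the right-hand sides. Infeasibility says that the
  -- homogeneous system has no solution with positive last coordinate.
  let a : Option (LinIneq ι) → ((ι → ℚ) × ℚ) →ₗ[ℚ] ℚ := fun o => o.elim
    (-LinearMap.snd ℚ (ι → ℚ) ℚ)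
    (fun c => (∑ j, (c.coeff j : ℚ) • (LinearMap.proj j ∘ₗ LinearMap.fst ℚ (ι → ℚ) ℚ)) -
      (c.rhs : ℚ) • LinearMap.snd ℚ (ι → ℚ) ℚ)
  have ha : ∀ c x, a (some c) x = ∑ j, (c.coeff j : ℚ) * x.1 j - c.rhs * x.2 := by
    intro c x
    simp [a]
  have ha' : ∀ x, a none x = -x.2 := fun x => by simp [a]
  obtain ⟨r, hr, hb⟩ := exists_nonneg_combination_of_forall_nonpos (Finset.insertNone F) a
    (LinearMap.snd ℚ (ι → ℚ) ℚ) (by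
      intro x hx
      by_contra hpos
      rw [LinearMap.snd_apply, not_le] at hpos
      refine h ⟨fun j => x.1 j / x.2, fun c hc => ?_⟩
      have := hx (some c) (by simpa using hc)
      rw [ha] at this
      rw [LinIneq.Holds]
      have h2 : ∑ j, (c.coeff j : ℚ) * (x.1 j / x.2) = (∑ j, (c.coeff j : ℚ) * x.1 j) / x.2 := by
        rw [Finset.sum_div]
        exact Finset.sum_congr rfl fun j _ => by ring
      rw [h2, div_le_iff₀ hpos]
      linarith)
  refine ⟨fun c => r (some c), fun c => hr _, fun w => ?_⟩
  -- At height `1` the Farkas identity says that the combined excess equals `1 + r none`.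
  have h1 := hb (w, 1)
  rw [Finset.sum_insertNone, ha', LinearMap.snd_apply] at h1
  simp only [ha, mul_one] at h1
  have h2 := hr none
  simp only [LinIneq.excess]
  linarith

/-! ### Extending circuits gate by gate -/

/-- Renaming the predecessors of a gate. -/
def GateLabel.map {V G H : Type} (e : G → H) : GateLabel V G → GateLabel V H
  | .input v => .input v
  | .op f g₁ g₂ => .op f (e g₁) (e g₂)

namespace MonotoneRealCircuit

variable {V : Type}

/-- The gate labels of a circuit with a new gate `none` on top. -/
def extendLabel (K : MonotoneRealCircuit V) (lab : GateLabel V K.Gate) :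
    Option K.Gate → GateLabel V (Option K.Gate)
  | none => lab.map some
  | some g => (K.label g).map some

theorem exists_some_of_gateEdge_extendLabel (K : MonotoneRealCircuit V)
    (lab : GateLabel V K.Gate) {g' g : Option K.Gate}
    (h : GateEdge (K.extendLabel lab) g' g) :
    ∃ k', g' = some k' ∧ ∀ k, g = some k → GateEdge K.label k' k := by
  obtain ⟨f, g₁, g₂, hl, hg⟩ := h
  cases g with
  | none =>
    cases lab with
    | input v => simp [extendLabel, GateLabel.map] at hl
    | op f' k₁ k₂ =>
      simp only [extendLabel, GateLabel.map, GateLabel.op.injEq] at hl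
      obtain ⟨-, rfl, rfl⟩ := hl
      rcases hg with rfl | rfl
      · exact ⟨k₁, rfl, by simp⟩
      · exact ⟨k₂, rfl, by simp⟩
  | some k =>
    cases hk : K.label k with
    | input v => simp [extendLabel, GateLabel.map, hk] at hl
    | op f' k₁ k₂ =>
      simp only [extendLabel, hk, GateLabel.map, GateLabel.op.injEq] at hl
      obtain ⟨-, rfl, rfl⟩ := hl
      rcases hg with rfl | rfl
      · exact ⟨k₁, rfl, fun l hl => by cases hl; exact ⟨f', k₁, k₂, hk, Or.inl rfl⟩⟩
      · exact ⟨k₂, rfl, fun l hl => by cases hl; exact ⟨f', k₁, k₂, hk, Or.inr rfl⟩⟩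

theorem exists_some_of_transGen_extendLabel (K : MonotoneRealCircuit V)
    (lab : GateLabel V K.Gate) {g' g : Option K.Gate}
    (h : Relation.TransGen (GateEdge (K.extendLabel lab)) g' g) :
    ∃ k', g' = some k' ∧ ∀ k, g = some k → Relation.TransGen (GateEdge K.label) k' k := by
  induction h with
  | single h =>
    obtain ⟨k', rfl, hk⟩ := K.exists_some_of_gateEdge_extendLabel lab h
    exact ⟨k', rfl, fun k h => .single (hk k h)⟩
  | tail _ h ih =>
    obtain ⟨k', rfl, hk'⟩ := ih
    obtain ⟨l, rfl, hl⟩ := K.exists_some_of_gateEdge_extendLabel lab h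
    exact ⟨k', rfl, fun k h => .tail (hk' l rfl) (hl k h)⟩

/-- The circuit with a new gate, which becomes the output. -/
def extend (K : MonotoneRealCircuit V) (lab : GateLabel V K.Gate) : MonotoneRealCircuit V where
  Gate := Option K.Gate
  fintypeGate := @instFintypeOption _ K.fintypeGate
  label := K.extendLabel lab
  acyclic g hg := by
    obtain ⟨k, rfl, hk⟩ := K.exists_some_of_transGen_extendLabel lab hg
    exact K.acyclic k (hk k rfl)
  output := none

theorem size_extend (K : MonotoneRealCircuit V) (lab : GateLabel V K.Gate) :
    (K.extend lab).size = K.size + 1 :=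
  @Fintype.card_option _ K.fintypeGate

/-- A gate of the circuit, as a gate of the extended circuit. -/
def oldGate (K : MonotoneRealCircuit V) (lab : GateLabel V K.Gate) (g : K.Gate) :
    (K.extend lab).Gate := some g

/-- The new gate of the extended circuit. -/
def newGate (K : MonotoneRealCircuit V) (lab : GateLabel V K.Gate) : (K.extend lab).Gate := none

theorem gateValue_oldGate (K : MonotoneRealCircuit V) (lab : GateLabel V K.Gate)
    (x : V → ℝ) (g : K.Gate) :
    (K.extend lab).gateValue x (K.oldGate lab g) = K.gateValue x g := by
  induction g using K.wellFounded_edge.induction with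
  | _ g ih =>
    have hl : (K.extend lab).label (K.oldGate lab g) = (K.label g).map (K.oldGate lab) := rfl
    cases hg : K.label g with
    | input v =>
      rw [hg] at hl
      rw [K.gateValue_input x hg, (K.extend lab).gateValue_input x hl]
    | op f g₁ g₂ =>
      rw [hg] at hl
      rw [K.gateValue_op x hg, (K.extend lab).gateValue_op x hl,
        ih g₁ ⟨f, g₁, g₂, hg, Or.inl rfl⟩, ih g₂ ⟨f, g₁, g₂, hg, Or.inr rfl⟩]

theorem gateValue_newGate_input (K : MonotoneRealCircuit V) (v : V) (x : V → ℝ) :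
    (K.extend (.input v)).gateValue x (K.newGate (.input v)) = x v :=
  gateValue_input (K.extend (.input v)) x (g := K.newGate (.input v)) (v := v) rfl

theorem gateValue_newGate_op (K : MonotoneRealCircuit V) (f : ℝ × ℝ →o ℝ)
    (g₁ g₂ : K.Gate) (x : V → ℝ) :
    (K.extend (.op f g₁ g₂)).gateValue x (K.newGate (.op f g₁ g₂)) =
      f (K.gateValue x g₁, K.gateValue x g₂) := by
  have hl : (K.extend (.op f g₁ g₂)).label (K.newGate (.op f g₁ g₂)) =
    .op f (K.oldGate (.op f g₁ g₂) g₁) (K.oldGate (.op f g₁ g₂) g₂) := rfl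
  rw [gateValue_op _ x hl, gateValue_oldGate, gateValue_oldGate]

/-- The circuit that consists of a single input gate. -/
def ofInput (v : V) : MonotoneRealCircuit V where
  Gate := Unit
  fintypeGate := inferInstance
  label _ := .input v
  acyclic g hg := by
    obtain ⟨_, _, f, g₁, g₂, h, -⟩ := Relation.TransGen.tail'_iff.1 hg
    cases h
  output := ()

theorem gateValue_ofInput (v : V) (x : V → ℝ) : (ofInput v).gateValue x () = x v :=
  gateValue_input (ofInput v) x (g := ()) (v := v) rfl

end MonotoneRealCircuit

/-! ### Derivations of Ferrers relations -/

/-- A relation between two types is Ferrers if it compares two real-valued functions. -/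
def IsFerrers {P Q : Type} (R : Set (P × Q)) : Prop :=
  ∃ (f : P → ℝ) (g : Q → ℝ), ∀ p q, (p, q) ∈ R ↔ f p < g q

/-- Only finitely many values occur, and a countable linear order embeds into `ℚ`. This permits the
nested lexicographic keys used below. -/
theorem isFerrers_of_linearOrder {P Q O : Type} [Finite P] [Finite Q] [LinearOrder O] (f : P → O)
    (g : Q → O) : IsFerrers {x : P × Q | f x.1 < g x.2} := by
  let S : Set O := Set.range f ∪ Set.range g
  have hS : S.Finite := (Set.finite_range f).union (Set.finite_range g)
  have : Countable S := hS.countable.to_subtype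
  obtain ⟨e⟩ := Order.embedding_from_countable_to_dense S ℚ
  refine ⟨fun p => (e ⟨f p, Or.inl ⟨p, rfl⟩⟩ : ℚ), fun q => (e ⟨g q, Or.inr ⟨q, rfl⟩⟩ : ℚ),
    fun p q => ?_⟩
  rw [Rat.cast_lt, e.lt_iff_lt]
  rfl

/-- A list of relations each of which compares an input variable, or is a Ferrers relation covered
by the union of two relations later in the list. -/
inductive FerrersDerivation {V P Q : Type} (u : V → P → ℝ) (w : V → Q → ℝ) :
    List (Set (P × Q)) → Prop
  | nil : FerrersDerivation u w []
  | input {l : List (Set (P × Q))} (j : V) (hl : FerrersDerivation u w l) :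
      FerrersDerivation u w ({x | u j x.1 < w j x.2} :: l)
  | step {l : List (Set (P × Q))} {R R₁ R₂ : Set (P × Q)} (hl : FerrersDerivation u w l)
      (hR : IsFerrers R) (h₁ : R₁ ∈ l) (h₂ : R₂ ∈ l) (h : R ⊆ R₁ ∪ R₂) :
      FerrersDerivation u w (R :: l)

/-- The least monotone function that is at least `g` on the points `(g₁ q, g₂ q)` and at least `m`
everywhere. -/
noncomputable def coverGate {Q : Type} [Finite Q] (g₁ g₂ g : Q → ℝ) (m : ℝ) : ℝ × ℝ →o ℝ where
  toFun s := sSup (insert m (g '' {q | g₁ q ≤ s.1 ∧ g₂ q ≤ s.2}))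
  monotone' s t hst := by
    refine csSup_le_csSup ((Set.toFinite _).bddAbove) ⟨m, Set.mem_insert _ _⟩ ?_
    exact Set.insert_subset_insert (Set.image_mono fun q hq =>
      ⟨hq.1.trans hst.1, hq.2.trans hst.2⟩)

theorem coverGate_le {Q : Type} [Finite Q] {g₁ g₂ g : Q → ℝ} {m b : ℝ} {s : ℝ × ℝ}
    (hm : m ≤ b) (h : ∀ q, g₁ q ≤ s.1 → g₂ q ≤ s.2 → g q ≤ b) : coverGate g₁ g₂ g m s ≤ b := by
  refine csSup_le ⟨m, Set.mem_insert _ _⟩ ?_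
  rintro _ (rfl | ⟨q, hq, rfl⟩)
  · exact hm
  · exact h q hq.1 hq.2

theorem le_coverGate {Q : Type} [Finite Q] {g₁ g₂ g : Q → ℝ} {m : ℝ} {s : ℝ × ℝ} {q : Q}
    (h₁ : g₁ q ≤ s.1) (h₂ : g₂ q ≤ s.2) : g q ≤ coverGate g₁ g₂ g m s :=
  le_csSup ((Set.toFinite _).bddAbove) (Or.inr ⟨q, ⟨h₁, h₂⟩, rfl⟩)

namespace MonotoneRealCircuit

variable {V P Q : Type} {u : V → P → ℝ} {w : V → Q → ℝ}

/-- Some gate of the circuit separates the points of `P` from those of `Q` on the relation `R`. -/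
def SeparatesOn (K : MonotoneRealCircuit V) (u : V → P → ℝ) (w : V → Q → ℝ)
    (R : Set (P × Q)) : Prop :=
  ∃ (k : K.Gate) (f : P → ℝ) (g : Q → ℝ), (∀ p q, (p, q) ∈ R ↔ f p < g q) ∧
    (∀ p, K.gateValue (fun j => u j p) k ≤ f p) ∧ ∀ q, g q ≤ K.gateValue (fun j => w j q) k

theorem SeparatesOn.extend {K : MonotoneRealCircuit V} {R : Set (P × Q)}
    (h : K.SeparatesOn u w R) (lab : GateLabel V K.Gate) : (K.extend lab).SeparatesOn u w R := by
  obtain ⟨k, f, g, hR, hf, hg⟩ := h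
  refine ⟨K.oldGate lab k, f, g, hR, fun p => ?_, fun q => ?_⟩
  · rw [gateValue_oldGate]
    exact hf p
  · rw [gateValue_oldGate]
    exact hg q

end MonotoneRealCircuit

/-- Each relation costs one gate. For a covering step, `coverGate` is large enough on `Q` by
construction; it is small enough on `P` because exceeding `f p` would put a pair into `R` that lies
in neither `R₁` nor `R₂`. -/
theorem FerrersDerivation.exists_circuit {V P Q : Type} [Finite P] [Finite Q] {u : V → P → ℝ}
    {w : V → Q → ℝ} {l : List (Set (P × Q))} (h : FerrersDerivation u w l) (hl : l ≠ []) :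
    ∃ K : MonotoneRealCircuit V, K.size = l.length ∧ ∀ R ∈ l, K.SeparatesOn u w R := by
  induction h with
  | nil => exact absurd rfl hl
  | @input l j h ih =>
    by_cases hn : l = []
    · subst hn
      refine ⟨.ofInput j, rfl, fun R hR => ?_⟩
      rw [List.mem_singleton] at hR
      subst hR
      refine ⟨(), u j, w j, fun p q => Iff.rfl, fun p => le_of_eq ?_, fun q => le_of_eq ?_⟩
      · exact MonotoneRealCircuit.gateValue_ofInput j _
      · exact (MonotoneRealCircuit.gateValue_ofInput j (fun j => w j q)).symm
    · obtain ⟨K, hK, hR⟩ := ih hn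
      refine ⟨K.extend (.input j), by rw [K.size_extend, hK, List.length_cons], fun R hm => ?_⟩
      rcases List.mem_cons.1 hm with rfl | hm
      · refine ⟨K.newGate _, u j, w j, fun p q => Iff.rfl, fun p => le_of_eq ?_, fun q => le_of_eq ?_⟩
        · exact K.gateValue_newGate_input j _
        · exact (K.gateValue_newGate_input j (fun j => w j q)).symm
      · exact (hR R hm).extend _
  | @step l R R₁ R₂ h hF h₁ h₂ hcov ih =>
    obtain ⟨K, hK, hR⟩ := ih (List.ne_nil_of_mem h₁)
    obtain ⟨k₁, f₁, g₁, hR₁, hf₁, hg₁⟩ := hR R₁ h₁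
    obtain ⟨k₂, f₂, g₂, hR₂, hf₂, hg₂⟩ := hR R₂ h₂
    obtain ⟨f, g, hfg⟩ := hF
    -- A lower bound of `f` serves as gate value where no `q` is dominated, so the supremum is never
    -- over the empty set.
    obtain ⟨m, hm⟩ := (Set.finite_range f).bddBelow
    refine ⟨K.extend (.op (coverGate g₁ g₂ g m) k₁ k₂),
      by rw [K.size_extend, hK, List.length_cons], fun S hS => ?_⟩
    rcases List.mem_cons.1 hS with rfl | hS
    · refine ⟨K.newGate _, f, g, hfg, fun p => ?_, fun q => ?_⟩
      · rw [K.gateValue_newGate_op]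
        refine coverGate_le (hm ⟨p, rfl⟩) fun q hq₁ hq₂ => ?_
        by_contra hlt
        rcases hcov ((hfg p q).2 (not_le.1 hlt)) with hc | hc
        · exact ((hR₁ p q).1 hc).not_ge (hq₁.trans (hf₁ p))
        · exact ((hR₂ p q).1 hc).not_ge (hq₂.trans (hf₂ p))
      · rw [K.gateValue_newGate_op]
        exact le_coverGate (hg₁ q) (hg₂ q)
    · exact (hR S hS).extend _

/-- A derivation of the full relation yields a circuit that is `0` on `P` and `1` on `Q`, and that
takes no other values. -/
theorem FerrersDerivation.exists_separating_circuit {V P Q : Type} [Finite P] [Finite Q]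
    {u : V → P → ℝ} {w : V → Q → ℝ} {l : List (Set (P × Q))} (h : FerrersDerivation u w l)
    (hl : Set.univ ∈ l) :
    ∃ K : MonotoneRealCircuit V, K.size = l.length + 1 ∧ (∀ x, K.eval x = 0 ∨ K.eval x = 1) ∧
      (∀ p, K.eval (fun j => u j p) = 0) ∧ ∀ q, K.eval (fun j => w j q) = 1 := by
  classical
  obtain ⟨K, hK, hR⟩ := h.exists_circuit (List.ne_nil_of_mem hl)
  obtain ⟨k, f, g, hfg, hf, hg⟩ := hR _ hl
  let t : ℝ × ℝ →o ℝ :=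
    { toFun := fun s => if ∃ q, g q ≤ s.1 then 1 else 0
      monotone' := by
        intro s s' hs
        by_cases hq : ∃ q, g q ≤ s.1
        · have hq' : ∃ q, g q ≤ s'.1 := hq.imp fun q h => h.trans hs.1
          simp only [if_pos hq, if_pos hq', le_refl]
        · simp only [if_neg hq]
          split_ifs <;> norm_num }
  have he : ∀ x, (K.extend (.op t k k)).eval x = if ∃ q, g q ≤ K.gateValue x k then 1 else 0 :=
    fun x => K.gateValue_newGate_op t k k x
  refine ⟨K.extend (.op t k k), by rw [K.size_extend, hK], fun x => ?_, fun p => ?_,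
    fun q => ?_⟩
  · rw [he]
    split_ifs
    · exact Or.inr rfl
    · exact Or.inl rfl
  · rw [he, if_neg]
    rintro ⟨q, hq⟩
    exact ((hfg p q).1 (Set.mem_univ _)).not_ge (hq.trans (hf p))
  · rw [he, if_pos ⟨q, hg q⟩]

/-! ### Derivations from branch-and-bound trees -/

/-- The relation `R` is contained in a relation of the list. -/
def CoveredBy {X : Type} (l : List (Set X)) (R : Set X) : Prop := ∃ S ∈ l, R ⊆ S

theorem CoveredBy.mono {X : Type} {l l' : List (Set X)} {R R' : Set X} (h : CoveredBy l R)
    (hl : l ⊆ l') (hR : R' ⊆ R) : CoveredBy l' R' := by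
  obtain ⟨S, hS, h⟩ := h
  exact ⟨S, hl hS, hR.trans h⟩

/-- The lexicographic comparison of `(κ, f)` with `(κ', g)`. -/
def lexRel {P Q O O' : Type} [LinearOrder O] [LinearOrder O'] (κ : P → O) (κ' : Q → O)
    (f : P → O') (g : Q → O') : Set (P × Q) :=
  {x | κ x.1 < κ' x.2 ∨ κ x.1 = κ' x.2 ∧ f x.1 < g x.2}

theorem isFerrers_lexRel {P Q O O' : Type} [Finite P] [Finite Q] [LinearOrder O] [LinearOrder O']
    (κ : P → O) (κ' : Q → O) (f : P → O') (g : Q → O') : IsFerrers (lexRel κ κ' f g) := by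
  have h := isFerrers_of_linearOrder (fun p => toLex (κ p, f p)) (fun q => toLex (κ' q, g q))
  simp only [Prod.Lex.toLex_lt_toLex] at h
  exact h

/-- The points of two finite types `P`, `Q` are combined to a rational point, such that the
excess of every inequality splits into a part from `Q` and a part from `P`, and such that the
excess of the inequalities in `base` is controlled by the input variables. -/
structure TwoPartySystem (ι V P Q : Type) [Fintype ι] [Fintype V] where
  point : P → Q → ι → ℚ
  lo : LinIneq ι → P → ℤ
  hi : LinIneq ι → Q → ℤ
  excess_point : ∀ c p q, c.excess (point p q) = hi c q - lo c p
  u : V → P → ℤ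
  w : V → Q → ℤ
  base : Finset (LinIneq ι)
  base_bound : ∀ c ∈ base, ∃ d : V → ℚ, (∀ j, 0 ≤ d j) ∧
    ∀ p q, c.excess (point p q) ≤ ∑ j, d j * (w j q - u j p)

namespace TwoPartySystem

variable {ι V P Q : Type} [Fintype ι] [Fintype V]

/-- Derivations whose input relations compare the variables of the system. -/
def Derivation (S : TwoPartySystem ι V P Q) (l : List (Set (P × Q))) : Prop :=
  FerrersDerivation (fun j p => (S.u j p : ℝ)) (fun j q => (S.w j q : ℝ)) l

/-- The derivation `l` can be extended by at most `N` relations to one that covers `R`. -/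
def Extends (S : TwoPartySystem ι V P Q) (l : List (Set (P × Q))) (N : ℕ)
    (R : Set (P × Q)) : Prop :=
  ∃ l', S.Derivation l' ∧ l ⊆ l' ∧ l'.length ≤ l.length + N ∧ CoveredBy l' R

theorem Derivation.cons {S : TwoPartySystem ι V P Q} {l : List (Set (P × Q))}
    {R R₁ R₂ : Set (P × Q)} (hl : S.Derivation l) (hR : IsFerrers R) (h₁ : CoveredBy l R₁)
    (h₂ : CoveredBy l R₂) (h : R ⊆ R₁ ∪ R₂) : S.Derivation (R :: l) := by
  obtain ⟨S₁, hS₁, h₁⟩ := h₁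
  obtain ⟨S₂, hS₂, h₂⟩ := h₂
  exact FerrersDerivation.step hl hR hS₁ hS₂ (h.trans (Set.union_subset_union h₁ h₂))

/-! ### Extending derivations: sums and binary search. -/

/-- Adding up inequalities. -/
theorem extends_sum [Finite P] [Finite Q] {O J : Type} [LinearOrder O]
    (S : TwoPartySystem ι V P Q) (κ : P → O) (κ' : Q → O) (s : Finset J) (r : J → ℚ)
    (hr : ∀ i ∈ s, 0 ≤ r i) (f : J → P → ℚ) (g : J → Q → ℚ) (f₀ : P → ℚ) (g₀ : Q → ℚ)
    {l : List (Set (P × Q))} (hl : S.Derivation l) (h₀ : CoveredBy l (lexRel κ κ' f₀ g₀))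
    (hs : ∀ i ∈ s, CoveredBy l {x | κ x.1 = κ' x.2 ∧ f i x.1 < g i x.2}) :
    S.Extends l s.card (lexRel κ κ' (fun p => f₀ p + ∑ i ∈ s, r i * f i p)
      (fun q => g₀ q + ∑ i ∈ s, r i * g i q)) := by
  classical
  induction s using Finset.induction_on with
  | empty => exact ⟨l, hl, List.Subset.refl _, le_rfl, by simpa using h₀⟩
  | insert k s hk ih =>
    obtain ⟨l', hl', hsub, hlen, hcov⟩ := ih (fun i hi => hr i (Finset.mem_insert_of_mem hi))
      (fun i hi => hs i (Finset.mem_insert_of_mem hi))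
    set R := lexRel κ κ' (fun p => f₀ p + ∑ i ∈ insert k s, r i * f i p)
      (fun q => g₀ q + ∑ i ∈ insert k s, r i * g i q) with hRdef
    refine ⟨R :: l', hl'.cons (isFerrers_lexRel _ _ _ _) hcov
      ((hs k (Finset.mem_insert_self _ _)).mono hsub subset_rfl) ?_,
      List.Subset.trans hsub (List.subset_cons_self _ _), ?_, R, List.mem_cons_self, subset_rfl⟩
    · rintro ⟨p, q⟩ (h | ⟨h, h'⟩)
      · exact Or.inl (Or.inl h)
      · simp only [Finset.sum_insert hk] at h'
        -- If the new summand does not increase from `p` to `q`, dropping it keeps the strict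
        -- inequality between the partial sums.
        by_cases hfg : f k p < g k q
        · exact Or.inr ⟨h, hfg⟩
        · refine Or.inl (Or.inr ⟨h, ?_⟩)
          have := mul_le_mul_of_nonneg_left (not_lt.1 hfg) (hr k (Finset.mem_insert_self _ _))
          show _ < _
          linarith
    · rw [List.length_cons, Finset.card_insert_of_notMem hk]
      omega

/-- Binary search for the values of `f` and `g`. -/
theorem extends_lexRel_of_refinements [Fintype P] [Finite Q] {O : Type} [LinearOrder O]
    (S : TwoPartySystem ι V P Q) (κ : P → O) (κ' : Q → O) (f : P → ℤ) (g : Q → ℤ)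
    {L N : ℕ} (hL : Fintype.card P < 2 ^ L) {l : List (Set (P × Q))} (hl : S.Derivation l)
    (h₀ : CoveredBy l {x | κ x.1 < κ' x.2})
    (step : ∀ (μ : P → O ×ₗ ℕ) (μ' : Q → O ×ₗ ℕ),
      (∀ p q, μ p = μ' q → κ p = κ' q ∧ f p < g q) → ∀ l₁, S.Derivation l₁ → l ⊆ l₁ →
      CoveredBy l₁ {x | μ x.1 < μ' x.2} → S.Extends l₁ N {x | μ x.1 ≤ μ' x.2}) :
    S.Extends l (L * N) (lexRel κ κ' f g) := by
  classical
  -- Ranks among the values of `f` replace the integers, whose size is not bounded, by numbers with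
  -- `L` binary digits.
  let ρ : ℤ → ℕ := fun t => (Finset.univ.filter fun p => f p < t).card
  have hρ : ∀ p t, f p < t ↔ ρ (f p) < ρ t := by
    intro p t
    constructor
    · intro h
      refine Finset.card_lt_card ⟨fun x hx => ?_, fun hsub => ?_⟩
      · rw [Finset.mem_filter] at hx ⊢
        exact ⟨hx.1, hx.2.trans h⟩
      · have := hsub (Finset.mem_filter.2 ⟨Finset.mem_univ p, h⟩)
        exact lt_irrefl _ (Finset.mem_filter.1 this).2
    · intro h
      by_contra hle
      refine h.not_ge (Finset.card_le_card fun x hx => ?_)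
      rw [Finset.mem_filter] at hx ⊢
      exact ⟨hx.1, hx.2.trans_le (not_lt.1 hle)⟩
  have hρL : ∀ t, ρ t < 2 ^ L := fun t => (Finset.card_le_univ _).trans_lt hL
  -- Comparison of the `k` leading digits of the ranks, refined by one digit in each round.
  have key : ∀ k e, e + k = L → S.Extends l (k * N)
      (lexRel κ κ' (fun p => ρ (f p) / 2 ^ e) (fun q => ρ (g q) / 2 ^ e)) := by
    intro k
    induction k with
    | zero =>
      intro e he
      refine ⟨l, hl, List.Subset.refl _, by omega, h₀.mono (List.Subset.refl _) ?_⟩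
      rintro x (h | ⟨-, h⟩)
      · exact h
      · have he' : e = L := he
        subst he'
        simp only [Nat.div_eq_of_lt (hρL _)] at h
        exact absurd h (lt_irrefl _)
    | succ k ih =>
      intro e he
      obtain ⟨l₁, hl₁, hsub, hlen, hcov⟩ := ih (e + 1) (by omega)
      have half : ∀ m : ℕ, m / 2 ^ (e + 1) = m / 2 ^ e / 2 := fun m => by
        rw [pow_succ, Nat.div_div_eq_div_mul]
      simp only [half] at hcov
      set a : P → ℕ := fun p => ρ (f p) / 2 ^ e with ha
      set b : Q → ℕ := fun q => ρ (g q) / 2 ^ e with hb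
      -- With the factor `3` and the shift by `1`, second components agree exactly if the higher
      -- digits agree and the current digit is `0` for `p` and `1` for `q`; they satisfy `<` exactly
      -- if `a p / 2 < b q / 2`. Hence `≤` means `a p < b q`.
      obtain ⟨l₂, hl₂, hsub₂, hlen₂, hcov₂⟩ :=
        step (fun p => toLex (κ p, 3 * (a p / 2) + a p % 2 + 1))
          (fun q => toLex (κ' q, 3 * (b q / 2) + b q % 2)) (by
            intro p q h
            have h := Prod.ext_iff.1 (toLex_inj.1 h)
            simp only at h
            refine ⟨h.1, ?_⟩
            rw [hρ]
            have hlt : a p < b q := by omega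
            by_contra hle
            exact hlt.not_ge (Nat.div_le_div_right (not_lt.1 hle))) l₁ hl₁ hsub
          (hcov.mono (List.Subset.refl _) (by
            rintro ⟨p, q⟩ h
            simp only [Set.mem_ofPred_eq, Prod.Lex.toLex_lt_toLex] at h
            rcases h with h | ⟨h, h'⟩
            · exact Or.inl h
            · refine Or.inr ⟨h, ?_⟩
              show a p / 2 < b q / 2
              omega))
      refine ⟨l₂, hl₂, List.Subset.trans hsub hsub₂, by rw [add_mul]; omega, hcov₂.mono
        (List.Subset.refl _) ?_⟩
      rintro ⟨p, q⟩ h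
      simp only [Set.mem_ofPred_eq, Prod.Lex.toLex_le_toLex]
      rcases h with h | ⟨h, h'⟩
      · exact Or.inl h
      · refine Or.inr ⟨h, ?_⟩
        have h' : a p < b q := h'
        omega
  obtain ⟨l', hl', hsub, hlen, hcov⟩ := key L 0 (by omega)
  refine ⟨l', hl', hsub, hlen, hcov.mono (List.Subset.refl _) ?_⟩
  rintro ⟨p, q⟩ (h | ⟨h, h'⟩)
  · exact Or.inl h
  · refine Or.inr ⟨h, ?_⟩
    simp only [pow_zero, Nat.div_one]
    exact (hρ p (g q)).1 h'

/-! ### Simulating a tree, with its cost recursion. -/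

/-- The number of relations needed for a tree with `s` leaves below `c` edge labels. -/
def cost (L v c s : ℕ) : ℕ := (c + s + v) * (s * L ^ Nat.log 2 s)

/-- The factor `L` falls on the smaller subtree, where it is absorbed because the total is at least
twice as large and so the logarithm grows by one. The extra label is absorbed by the leaves of the
other subtree. -/
theorem cost_node {L v c s t : ℕ} (hL : 0 < L) (hs : 0 < s) (hst : s ≤ t) :
    L * cost L v (c + 1) s + cost L v (c + 1) t ≤ cost L v c (s + t) := by
  have hlog : Nat.log 2 s + 1 ≤ Nat.log 2 (s + t) := by
    rw [← Nat.log_mul_base one_lt_two hs.ne']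
    exact Nat.log_mono_right (by omega)
  have h1 : L * (s * L ^ Nat.log 2 s) ≤ s * L ^ Nat.log 2 (s + t) := by
    calc L * (s * L ^ Nat.log 2 s) = s * L ^ (Nat.log 2 s + 1) := by ring
      _ ≤ _ := Nat.mul_le_mul_left _ (Nat.pow_le_pow_right hL hlog)
  have h2 : t * L ^ Nat.log 2 t ≤ t * L ^ Nat.log 2 (s + t) :=
    Nat.mul_le_mul_left _ (Nat.pow_le_pow_right hL (Nat.log_mono_right (by omega)))
  calc L * cost L v (c + 1) s + cost L v (c + 1) t
      = (c + 1 + s + v) * (L * (s * L ^ Nat.log 2 s)) +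
        (c + 1 + t + v) * (t * L ^ Nat.log 2 t) := by unfold cost; ring
    _ ≤ (c + (s + t) + v) * (s * L ^ Nat.log 2 (s + t)) +
        (c + (s + t) + v) * (t * L ^ Nat.log 2 (s + t)) :=
      Nat.add_le_add (Nat.mul_le_mul (by omega) h1) (Nat.mul_le_mul (by omega) h2)
    _ = cost L v c (s + t) := by unfold cost; ring

theorem cost_mono {L v c c' s : ℕ} (h : c ≤ c') : cost L v c s ≤ cost L v c' s :=
  Nat.mul_le_mul_right _ (by omega)

/-- The tree `T` can be simulated: if all labels of `Γ` are available where the keys agree, and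
`T` is a valid tree below `Γ`, then one can pass from `κ < κ'` to `κ ≤ κ'`. -/
def Simulates (S : TwoPartySystem ι V P Q) (L : ℕ) (T : BBTree ι) : Prop :=
  ∀ (O : Type) [LinearOrder O] (κ : P → O) (κ' : Q → O) (Γ : Finset (LinIneq ι))
    (l : List (Set (P × Q))), S.Derivation l →
    (∀ j, CoveredBy l {x | S.u j x.1 < S.w j x.2}) →
    CoveredBy l {x | κ x.1 < κ' x.2} →
    (∀ c ∈ Γ, CoveredBy l {x | κ x.1 = κ' x.2 ∧ S.lo c x.1 < S.hi c x.2}) →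
    T.IsProofFor (Γ ∪ S.base : Set (LinIneq ι)) →
    S.Extends l (cost L (Fintype.card V) Γ.card T.size) {x | κ x.1 ≤ κ' x.2}

/-- The Farkas combination is positive at every combined point, so where the keys agree its `P`-part
is below its `Q`-part. -/
theorem simulates_leaf [Finite P] [Finite Q] (S : TwoPartySystem ι V P Q) (L : ℕ) :
    S.Simulates L .leaf := by
  classical
  intro O _ κ κ' Γ l hl hin h₀ hΓ hT
  obtain ⟨r, hr, hpos⟩ := exists_combination_excess_pos (Γ ∪ S.base)
    (by rw [Finset.coe_union]; exact hT)
  have hd : ∀ c, ∃ d : V → ℚ, (∀ j, 0 ≤ d j) ∧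
      (c ∈ S.base → ∀ p q, c.excess (S.point p q) ≤ ∑ j, d j * (S.w j q - S.u j p)) := by
    intro c
    by_cases hc : c ∈ S.base
    · obtain ⟨d, h, h'⟩ := S.base_bound c hc
      exact ⟨d, h, fun _ => h'⟩
    · exact ⟨0, fun _ => le_rfl, fun h => absurd h hc⟩
  choose d hd hd' using hd
  obtain ⟨l₁, hl₁, hsub₁, hlen₁, hcov₁⟩ := S.extends_sum κ κ' Γ r (fun c _ => hr c)
    (fun c p => (S.lo c p : ℚ)) (fun c q => (S.hi c q : ℚ)) (fun _ => 0) (fun _ => 0) hl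
    (h₀.mono (List.Subset.refl _) (by
      rintro x (h | ⟨-, h⟩)
      · exact h
      · exact absurd h (lt_irrefl _)))
    (by simpa only [Int.cast_lt] using hΓ)
  -- The base inequalities enter only through their bounds by input variables, so they cost `|V|`
  -- steps however many there are.
  obtain ⟨l₂, hl₂, hsub₂, hlen₂, hcov₂⟩ := S.extends_sum κ κ' Finset.univ
    (fun j => ∑ c ∈ S.base \ Γ, r c * d c j)
    (fun j _ => Finset.sum_nonneg fun c _ => mul_nonneg (hr c) (hd c j))
    (fun j p => (S.u j p : ℚ)) (fun j q => (S.w j q : ℚ)) _ _ hl₁ hcov₁ (fun j _ =>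
      (hin j).mono hsub₁ fun x hx => by simpa using hx.2)
  refine ⟨l₂, hl₂, List.Subset.trans hsub₁ hsub₂, ?_, hcov₂.mono (List.Subset.refl _) ?_⟩
  · rw [Finset.card_univ] at hlen₂
    simp only [cost, BBTree.size, Nat.log_one_right, pow_zero, mul_one]
    omega
  · rintro ⟨p, q⟩ hle
    rcases lt_or_eq_of_le (show κ p ≤ κ' q from hle) with h | h
    · exact Or.inl h
    · refine Or.inr ⟨h, ?_⟩
      have h1 := hpos (S.point p q)
      rw [← Finset.union_sdiff_self_eq_union, Finset.sum_union Finset.disjoint_sdiff] at h1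
      have h2 : ∑ c ∈ S.base \ Γ, r c * c.excess (S.point p q) ≤
          ∑ c ∈ S.base \ Γ, r c * ∑ j, d c j * (S.w j q - S.u j p) :=
        Finset.sum_le_sum fun c hc => mul_le_mul_of_nonneg_left
          (hd' c (Finset.mem_sdiff.1 hc).1 p q) (hr c)
      have h3 : ∑ c ∈ S.base \ Γ, r c * ∑ j, d c j * (S.w j q - S.u j p) =
          ∑ j, (∑ c ∈ S.base \ Γ, r c * d c j) * S.w j q -
            ∑ j, (∑ c ∈ S.base \ Γ, r c * d c j) * S.u j p := by
        simp only [Finset.mul_sum, Finset.sum_mul]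
        rw [Finset.sum_comm, ← Finset.sum_sub_distrib]
        refine Finset.sum_congr rfl fun j _ => ?_
        rw [← Finset.sum_sub_distrib]
        exact Finset.sum_congr rfl fun c _ => by ring
      have h4 : ∑ c ∈ Γ, r c * c.excess (S.point p q) =
          ∑ c ∈ Γ, r c * S.hi c q - ∑ c ∈ Γ, r c * S.lo c p := by
        rw [← Finset.sum_sub_distrib]
        exact Finset.sum_congr rfl fun c _ => by rw [S.excess_point]; ring
      show _ < _
      simp only [zero_add]
      linarith

/-- The smaller of the two subtrees is used repeatedly to derive the label of the larger one. -/
theorem extends_node [Fintype P] [Finite Q] (S : TwoPartySystem ι V P Q) {L : ℕ}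
    (hLpos : 0 < L) (hL : Fintype.card P < 2 ^ L) {T T' : BBTree ι} (hT : S.Simulates L T)
    (hT' : S.Simulates L T') (hsize : 0 < T.size) (hle : T.size ≤ T'.size) {c c' : LinIneq ι}
    (hc : ∀ x, c.excess x + c'.excess x = 1)
    {O : Type} [LinearOrder O] (κ : P → O) (κ' : Q → O) (Γ : Finset (LinIneq ι))
    (l : List (Set (P × Q))) (hl : S.Derivation l)
    (hin : ∀ j, CoveredBy l {x | S.u j x.1 < S.w j x.2})
    (h₀ : CoveredBy l {x | κ x.1 < κ' x.2})
    (hΓ : ∀ c ∈ Γ, CoveredBy l {x | κ x.1 = κ' x.2 ∧ S.lo c x.1 < S.hi c x.2})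
    (h : T.IsProofFor (insert c (Γ ∪ S.base : Set (LinIneq ι))))
    (h' : T'.IsProofFor (insert c' (Γ ∪ S.base : Set (LinIneq ι)))) :
    S.Extends l (cost L (Fintype.card V) Γ.card (T.size + T'.size)) {x | κ x.1 ≤ κ' x.2} := by
  classical
  -- Integrality enters here: two integers with sum `1` are not both positive.
  have hcc : ∀ p q, S.lo c' p < S.hi c' q → ¬ S.lo c p < S.hi c q := by
    intro p q h1 h2
    have h3 := hc (S.point p q)
    rw [S.excess_point, S.excess_point] at h3
    have h4 : S.hi c q - S.lo c p + (S.hi c' q - S.lo c' p) = 1 := by exact_mod_cast h3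
    omega
  have hN : ∀ d : LinIneq ι, (insert d Γ).card ≤ Γ.card + 1 := fun d => Finset.card_insert_le _ _
  -- `T` is run once per digit, on pairs violating `c'`. There its label `c` is never violated, so
  -- the relation that `T` requires for `c` is empty.
  obtain ⟨l₁, hl₁, hsub₁, hlen₁, hcov₁⟩ := S.extends_lexRel_of_refinements κ κ' (S.lo c') (S.hi c')
    (N := cost L (Fintype.card V) (insert c Γ).card T.size) hL hl h₀ (by
      intro μ μ' hμ l₁ hl₁ hsub hcov
      refine hT _ μ μ' (insert c Γ) l₁ hl₁ (fun j => (hin j).mono hsub subset_rfl) hcov ?_ ?_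
      · intro e he
        rcases Finset.mem_insert.1 he with rfl | he
        · refine hcov.mono (List.Subset.refl _) ?_
          rintro ⟨p, q⟩ ⟨h1, h2⟩
          exact absurd h2 (hcc p q (hμ p q h1).2)
        · refine (hΓ e he).mono hsub ?_
          rintro ⟨p, q⟩ ⟨h1, h2⟩
          exact ⟨(hμ p q h1).1, h2⟩
      · rwa [Finset.coe_insert, Set.insert_union])
  obtain ⟨l₂, hl₂, hsub₂, hlen₂, hcov₂⟩ := hT' O κ κ' (insert c' Γ) l₁ hl₁
    (fun j => (hin j).mono hsub₁ subset_rfl) (h₀.mono hsub₁ subset_rfl) (by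
      intro e he
      rcases Finset.mem_insert.1 he with rfl | he
      · exact hcov₁.mono (List.Subset.refl _) fun x hx => Or.inr hx
      · exact (hΓ e he).mono hsub₁ subset_rfl) (by rwa [Finset.coe_insert, Set.insert_union])
  refine ⟨l₂, hl₂, List.Subset.trans hsub₁ hsub₂, ?_, hcov₂⟩
  have h1 := cost_node (v := Fintype.card V) (c := Γ.card) hLpos hsize hle
  have h2 := Nat.mul_le_mul_left L (cost_mono (L := L) (v := Fintype.card V) (s := T.size) (hN c))
  have h3 := cost_mono (L := L) (v := Fintype.card V) (s := T'.size) (hN c')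
  omega

end TwoPartySystem

theorem BBTree.size_pos {ι : Type} (T : BBTree ι) : 0 < T.size := by
  induction T with
  | leaf => exact one_pos
  | node α δ l r hl hr => exact Nat.add_pos_left hl _

theorem LinIneq.excess_add_excess_neg {ι : Type} [Fintype ι] (α : ι → ℤ) (δ : ℤ) (x : ι → ℚ) :
    LinIneq.excess ⟨α, δ⟩ x + LinIneq.excess ⟨-α, -(δ + 1)⟩ x = 1 := by
  simp [LinIneq.excess]
  ring

namespace TwoPartySystem

variable {ι V P Q : Type} [Fintype ι] [Fintype V]

theorem simulates [Fintype P] [Finite Q] (S : TwoPartySystem ι V P Q) {L : ℕ}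
    (hLpos : 0 < L) (hL : Fintype.card P < 2 ^ L) (T : BBTree ι) : S.Simulates L T := by
  induction T with
  | leaf => exact S.simulates_leaf L
  | node α δ T₁ T₂ h₁ h₂ =>
    intro O _ κ κ' Γ l hl hin h₀ hΓ hT
    rcases le_total T₁.size T₂.size with hle | hle
    · exact S.extends_node hLpos hL h₁ h₂ T₁.size_pos hle (LinIneq.excess_add_excess_neg α δ) κ κ' Γ l
        hl hin h₀ hΓ hT.1 hT.2
    · rw [BBTree.size, add_comm]
      exact S.extends_node hLpos hL h₂ h₁ T₂.size_pos hle
        (fun x => by rw [add_comm, LinIneq.excess_add_excess_neg α δ]) κ κ' Γ l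
        hl hin h₀ hΓ hT.2 hT.1

/-- A branch-and-bound tree for the base inequalities yields a circuit that is `0` on `P` and `1`
on `Q`. -/
theorem exists_circuit [Fintype P] [Finite Q] [Nonempty V] (S : TwoPartySystem ι V P Q) {L : ℕ}
    (hLpos : 0 < L) (hL : Fintype.card P < 2 ^ L) (T : BBTree ι) (hT : T.IsProofFor (S.base : Set (LinIneq ι))) :
    ∃ K : MonotoneRealCircuit V,
      K.size ≤ Fintype.card V + cost L (Fintype.card V) 0 T.size + 1 ∧
      (∀ x, K.eval x = 0 ∨ K.eval x = 1) ∧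
      (∀ p, K.eval (fun j => (S.u j p : ℝ)) = 0) ∧
      ∀ q, K.eval (fun j => (S.w j q : ℝ)) = 1 := by
  classical
  have hinputs : ∀ s : List V, S.Derivation
      (s.map fun j => {x : P × Q | (S.u j x.1 : ℝ) < S.w j x.2}) := by
    intro s
    induction s with
    | nil => exact .nil
    | cons j s ih => exact FerrersDerivation.input j ih
  -- With constant keys, `κ < κ'` is the empty relation and `κ ≤ κ'` is everything.
  obtain ⟨l, hl, -, hlen, R, hR, hcov⟩ := S.simulates hLpos hL T Unit (fun _ => ()) (fun _ => ()) ∅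
    _ (hinputs Finset.univ.toList)
    (fun j => ⟨_, List.mem_map.2 ⟨j, Finset.mem_toList.2 (Finset.mem_univ j), rfl⟩,
      fun x hx => by simpa using hx⟩)
    (by
      obtain ⟨j⟩ := ‹Nonempty V›
      exact ⟨_, List.mem_map.2 ⟨j, Finset.mem_toList.2 (Finset.mem_univ j), rfl⟩,
        fun x hx => absurd hx (lt_irrefl ())⟩)
    (by simp) (by simpa using hT)
  have huniv : Set.univ ∈ l := by
    have : R = Set.univ := Set.eq_univ_of_univ_subset fun x _ => hcov (le_refl ())
    exact this ▸ hR
  obtain ⟨K, hK, h⟩ := FerrersDerivation.exists_separating_circuit hl huniv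
  refine ⟨K, ?_, h⟩
  rw [List.length_map, Finset.length_toList, Finset.card_univ, Finset.card_empty] at hlen
  omega

end TwoPartySystem

/-! ### The split system -/

/-- A vector of truth values, regarded as a binary vector. -/
def boolVec {ι : Type} (s : ι → Bool) : ι → ℤ := fun i => if s i then 1 else 0

theorem isBinary_boolVec {ι : Type} (s : ι → Bool) : IsBinary (boolVec s) := by
  intro i
  unfold boolVec
  split_ifs
  · exact Or.inr rfl
  · exact Or.inl rfl

theorem IsBinary.exists_boolVec {ι : Type} {v : ι → ℤ} (h : IsBinary v) :
    ∃ s, boolVec s = v := by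
  refine ⟨fun i => decide (v i = 1), funext fun i => ?_⟩
  rcases h i with h | h <;> simp [boolVec, h]

/-- The pairs of binary vectors `(u, z)` with `M u + N z ≤ c`. -/
abbrev FeasiblePair {p q m : ℕ} (M : Matrix (Fin m) (Fin p) ℤ) (N : Matrix (Fin m) (Fin q) ℤ)
    (c : Fin m → ℤ) : Type :=
  {s : (Fin p → Bool) × (Fin q → Bool) // M.mulVec (boolVec s.1) ≤ c - N.mulVec (boolVec s.2)}

noncomputable instance {p q m : ℕ} (M : Matrix (Fin m) (Fin p) ℤ)
    (N : Matrix (Fin m) (Fin q) ℤ) (c : Fin m → ℤ) : Fintype (FeasiblePair M N c) :=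
  Fintype.ofFinite _

theorem exists_feasiblePair {p q m : ℕ} {M : Matrix (Fin m) (Fin p) ℤ}
    {N : Matrix (Fin m) (Fin q) ℤ} {c : Fin m → ℤ} {z : Fin q → ℤ} (hz : z ∈ feasibleSet M N c) :
    ∃ s : FeasiblePair M N c, boolVec s.1.2 = z := by
  obtain ⟨hb, u, hu, h⟩ := hz
  obtain ⟨s, rfl⟩ := hu.exists_boolVec
  obtain ⟨t, rfl⟩ := hb.exists_boolVec
  exact ⟨⟨(s, t), h⟩, rfl⟩

theorem FeasiblePair.row_le {p q m : ℕ} {M : Matrix (Fin m) (Fin p) ℤ}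
    {N : Matrix (Fin m) (Fin q) ℤ} {c : Fin m → ℤ} (s : FeasiblePair M N c) (i : Fin m) :
    ∑ j, (M i j : ℚ) * boolVec s.1.1 j + ∑ j, (N i j : ℚ) * boolVec s.1.2 j ≤ c i := by
  have h := s.2 i
  simp only [Matrix.mulVec, dotProduct, Pi.sub_apply] at h
  have h' : ∑ j, M i j * boolVec s.1.1 j + ∑ j, N i j * boolVec s.1.2 j ≤ c i := by linarith
  exact_mod_cast h'

theorem card_feasiblePair_le {p q m : ℕ} (M : Matrix (Fin m) (Fin p) ℤ)
    (N : Matrix (Fin m) (Fin q) ℤ) (c : Fin m → ℤ) :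
    Fintype.card (FeasiblePair M N c) ≤ 2 ^ (p + q) := by
  refine (Fintype.card_le_of_injective _ Subtype.val_injective).trans (le_of_eq ?_)
  simp [pow_add]

theorem finite_splitRelaxation {n₁ n₂ n₃ m₁ m₂ : ℕ}
    (A : Matrix (Fin m₁) (Fin n₁) ℤ) (B : Matrix (Fin m₂) (Fin n₂) ℤ)
    (C : Matrix (Fin m₁) (Fin n₃) ℤ) (D : Matrix (Fin m₂) (Fin n₃) ℤ)
    (a : Fin m₁ → ℤ) (b : Fin m₂ → ℤ) : (splitRelaxation A B C D a b).Finite :=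
  (((Set.finite_range _).union (Set.finite_range _)).union (Set.finite_range _)).union
    (Set.finite_range _)

/-- The point with the given binary coordinates. -/
def splitPoint {n₁ n₂ n₃ : ℕ} (x : Fin n₁ → Bool) (y : Fin n₂ → Bool) (z : Fin n₃ → Bool) :
    SplitVar n₁ n₂ n₃ → ℚ :=
  Sum.elim (fun i => boolVec x i) (Sum.elim (fun i => boolVec y i) (fun i => boolVec z i))

theorem excess_splitPoint {n₁ n₂ n₃ : ℕ} (c : LinIneq (SplitVar n₁ n₂ n₃)) (x : Fin n₁ → Bool)
    (y : Fin n₂ → Bool) (z : Fin n₃ → Bool) :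
    c.excess (splitPoint x y z) = ∑ i, (c.coeff (.inl i) : ℚ) * boolVec x i +
      (∑ i, (c.coeff (.inr (.inl i)) : ℚ) * boolVec y i +
        ∑ i, (c.coeff (.inr (.inr i)) : ℚ) * boolVec z i) - c.rhs := by
  simp [LinIneq.excess, splitPoint, Fintype.sum_sum_type]

theorem splitPoint_mem_Icc {n₁ n₂ n₃ : ℕ} (x : Fin n₁ → Bool) (y : Fin n₂ → Bool)
    (z : Fin n₃ → Bool) (j : SplitVar n₁ n₂ n₃) :
    0 ≤ splitPoint x y z j ∧ splitPoint x y z j ≤ 1 := by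
  have h : ∀ {m : ℕ} (s : Fin m → Bool) i, (0 : ℚ) ≤ boolVec s i ∧ (boolVec s i : ℚ) ≤ 1 := by
    intro m s i
    rcases isBinary_boolVec s i with h | h <;> simp [h]
  rcases j with j | j | j
  · exact h x j
  · exact h y j
  · exact h z j

/-- The split system as a two-party system: one party knows `(x, z)`, the other one `(y, z')`,
and the combined point is `(x, y, z)`. -/
noncomputable def splitTwoPartySystem {n₁ n₂ n₃ m₁ m₂ : ℕ}
    (A : Matrix (Fin m₁) (Fin n₁) ℤ) (B : Matrix (Fin m₂) (Fin n₂) ℤ)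
    (C : Matrix (Fin m₁) (Fin n₃) ℤ) (D : Matrix (Fin m₂) (Fin n₃) ℤ)
    (a : Fin m₁ → ℤ) (b : Fin m₂ → ℤ) (hD : ∀ i j, D i j ≤ 0) :
    TwoPartySystem (SplitVar n₁ n₂ n₃) (Fin n₃) (FeasiblePair A C a) (FeasiblePair B D b) where
  point p q := splitPoint p.1.1 q.1.1 p.1.2
  lo c p := -(∑ i, c.coeff (.inl i) * boolVec p.1.1 i +
    ∑ i, c.coeff (.inr (.inr i)) * boolVec p.1.2 i)
  hi c q := ∑ i, c.coeff (.inr (.inl i)) * boolVec q.1.1 i - c.rhs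
  excess_point c p q := by
    rw [excess_splitPoint]
    push_cast
    ring
  u j p := boolVec p.1.2 j
  w j q := boolVec q.1.2 j
  base := (finite_splitRelaxation A B C D a b).toFinset
  base_bound c hc := by
    rw [Set.Finite.mem_toFinset] at hc
    rcases hc with ((⟨i, rfl⟩ | ⟨i, rfl⟩) | ⟨j, rfl⟩) | ⟨j, rfl⟩
    -- The combined point has both `x` and `z` from `p`, so rows of the first block hold.
    · refine ⟨0, fun _ => le_rfl, fun p q => ?_⟩
      have h := p.row_le i
      rw [excess_splitPoint]
      simp only [Sum.elim_inl, Sum.elim_inr, Pi.zero_apply, Int.cast_zero, zero_mul,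
        Finset.sum_const_zero, zero_add]
      linarith
    -- Row `i` holds at `(y, z')`; replacing `z'` by `z` changes its left side by `∑ -D i j * (z' j
    -- - z j)`, with nonnegative coefficients.
    · refine ⟨fun j => -(D i j : ℚ), fun j => ?_, fun p q => ?_⟩
      · have : (D i j : ℚ) ≤ 0 := by exact_mod_cast hD i j
        linarith
      · have h := q.row_le i
        rw [excess_splitPoint]
        simp only [Sum.elim_inl, Sum.elim_inr, Pi.zero_apply, Int.cast_zero, zero_mul,
          Finset.sum_const_zero, zero_add, mul_sub, neg_mul, Finset.sum_sub_distrib,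
          Finset.sum_neg_distrib]
        linarith
    · refine ⟨0, fun _ => le_rfl, fun p q => ?_⟩
      have h := (splitPoint_mem_Icc p.1.1 q.1.1 p.1.2 j).2
      simpa [LinIneq.excess, Pi.single_apply] using h
    · refine ⟨0, fun _ => le_rfl, fun p q => ?_⟩
      have h := (splitPoint_mem_Icc p.1.1 q.1.1 p.1.2 j).1
      simpa [LinIneq.excess, Pi.single_apply] using h

/-- With `L ≤ n + 1`, the size is at most `2 (n + 1) s² (n + 1) ^ log s`. Both the base and the
exponent of the last power are below those in the target, whose base is at least `1`. -/
theorem cost_le_interpolationBound {n₁ n₂ n₃ s : ℕ} (hn₃ : 0 < n₃) (hs : 0 < s) :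
    ((n₃ + TwoPartySystem.cost (n₁ + n₃ + 1) n₃ 0 s + 1 : ℕ) : ℝ) ≤
      interpolationBound (n₁ + n₂ + n₃) s := by
  set n := n₁ + n₂ + n₃ with hn
  set k := Nat.log 2 s with hk
  set W : ℝ := ((n : ℝ) + 2) ^ 2 * Real.logb 2 (10 * (n : ℝ) ^ 3 + 3) with hW
  have hn0 : (0 : ℝ) ≤ n := Nat.cast_nonneg n
  have hn1 : (1 : ℝ) ≤ n := by exact_mod_cast (by omega : 1 ≤ n)
  have hs1 : (1 : ℝ) ≤ s := by exact_mod_cast hs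
  have hlog : 1 ≤ Real.logb 2 (10 * (n : ℝ) ^ 3 + 3) := by
    rw [Real.le_logb_iff_rpow_le one_lt_two (by positivity), Real.rpow_one]
    have : (0 : ℝ) ≤ (n : ℝ) ^ 3 := by positivity
    linarith
  have hLW : ((n : ℝ) + 1) ≤ W := by
    have : ((n : ℝ) + 2) ^ 2 * 1 ≤ W := mul_le_mul_of_nonneg_left hlog (by positivity)
    nlinarith
  have hW1 : 1 ≤ W := by linarith
  have hexp : (k : ℝ) ≤ Real.logb 2 ((4 * (n : ℝ) + 5) * (s : ℝ)) := by
    rw [Real.le_logb_iff_rpow_le one_lt_two (by positivity), Real.rpow_natCast]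
    have h1 : (2 : ℝ) ^ k ≤ s := by exact_mod_cast Nat.pow_log_le_self 2 hs.ne'
    nlinarith
  have hpow : (((n + 1) ^ k : ℕ) : ℝ) ≤ W ^ Real.logb 2 ((4 * (n : ℝ) + 5) * (s : ℝ)) := by
    push_cast
    calc ((n : ℝ) + 1) ^ k ≤ W ^ k := pow_le_pow_left₀ (by positivity) hLW k
      _ = W ^ (k : ℝ) := (Real.rpow_natCast W k).symm
      _ ≤ _ := Real.rpow_le_rpow_of_exponent_le hW1 hexp
  have hnat : n₃ + TwoPartySystem.cost (n₁ + n₃ + 1) n₃ 0 s + 1 ≤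
      2 * (n + 1) * s ^ 2 * (n + 1) ^ k := by
    have h1 : (n₁ + n₃ + 1) ^ k ≤ (n + 1) ^ k := Nat.pow_le_pow_left (by omega) k
    have h2 : 1 ≤ (n + 1) ^ k := Nat.one_le_pow _ _ (by omega)
    have h3 : 0 + s + n₃ ≤ (n + 1) * s := by nlinarith
    have h4 : TwoPartySystem.cost (n₁ + n₃ + 1) n₃ 0 s ≤ (n + 1) * s * (s * (n + 1) ^ k) :=
      Nat.mul_le_mul h3 (Nat.mul_le_mul_left s h1)
    have h5 : (n + 1) * 1 ≤ (n + 1) * (s ^ 2 * (n + 1) ^ k) :=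
      Nat.mul_le_mul_left _ (Nat.one_le_iff_ne_zero.2 (by positivity))
    calc n₃ + TwoPartySystem.cost (n₁ + n₃ + 1) n₃ 0 s + 1
        ≤ (n + 1) * (s ^ 2 * (n + 1) ^ k) + (n + 1) * s * (s * (n + 1) ^ k) := by omega
      _ = _ := by ring
  have hfac : 2 * ((n : ℝ) + 1) * (s : ℝ) ^ 2 ≤ 50 * ((n : ℝ) + 1) ^ 2 * (s : ℝ) ^ 2 :=
    mul_le_mul_of_nonneg_right (by nlinarith) (by positivity)
  calc ((n₃ + TwoPartySystem.cost (n₁ + n₃ + 1) n₃ 0 s + 1 : ℕ) : ℝ)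
      ≤ ((2 * (n + 1) * s ^ 2 * (n + 1) ^ k : ℕ) : ℝ) := Nat.cast_le.2 hnat
    _ = 2 * ((n : ℝ) + 1) * (s : ℝ) ^ 2 * (((n + 1) ^ k : ℕ) : ℝ) := by push_cast; ring
    _ ≤ interpolationBound n s := mul_le_mul hfac hpow (Nat.cast_nonneg _) (by positivity)

theorem mainTheorem1 (n₁ n₂ n₃ m₁ m₂ : ℕ) (hn₃ : 0 < n₃)
    (A : Matrix (Fin m₁) (Fin n₁) ℤ) (B : Matrix (Fin m₂) (Fin n₂) ℤ)
    (C : Matrix (Fin m₁) (Fin n₃) ℤ) (D : Matrix (Fin m₂) (Fin n₃) ℤ)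
    (a : Fin m₁ → ℤ) (b : Fin m₂ → ℤ)
    (hC : ∀ i j, 0 ≤ C i j) (hD : ∀ i j, D i j ≤ 0)
    (T : BBTree (SplitVar n₁ n₂ n₃)) (hT : T.IsProofFor (splitRelaxation A B C D a b)) :
    ∃ K : MonotoneRealCircuit (Fin n₃),
      (K.size : ℝ) ≤ interpolationBound (n₁ + n₂ + n₃) T.size ∧
      K.Separates (toRealVec '' feasibleSet A C a) (toRealVec '' feasibleSet B D b) ∧
      K.ComputesInterpolant (feasibleSet A C a) (feasibleSet B D b) := by
  have : Nonempty (Fin n₃) := ⟨⟨0, hn₃⟩⟩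
  -- There are at most `2 ^ (n₁ + n₃)` pairs; the extra digit makes the inequality strict, as ranks
  -- can equal the number of pairs.
  have hcard : Fintype.card (FeasiblePair A C a) < 2 ^ (n₁ + n₃ + 1) :=
    (card_feasiblePair_le A C a).trans_lt (Nat.pow_lt_pow_right one_lt_two (by omega))
  obtain ⟨K, hsize, hbin, h0, h1⟩ := (splitTwoPartySystem A B C D a b hD).exists_circuit
    (Nat.succ_pos _) hcard T (by
      rwa [splitTwoPartySystem, Set.Finite.coe_toFinset])
  have hZ₁ : ∀ z ∈ feasibleSet A C a, K.eval (toRealVec z) = 0 := by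
    intro z hz
    obtain ⟨p, rfl⟩ := exists_feasiblePair hz
    exact h0 p
  have hZ₂ : ∀ z ∈ feasibleSet B D b, K.eval (toRealVec z) = 1 := by
    intro z hz
    obtain ⟨q, rfl⟩ := exists_feasiblePair hz
    exact h1 q
  refine ⟨K, ?_, Or.inr ⟨?_, ?_⟩, fun z _ => ⟨hbin _, fun h hz => ?_, fun h hz => ?_⟩⟩
  · rw [Fintype.card_fin] at hsize
    exact (Nat.cast_le.2 hsize).trans (cost_le_interpolationBound hn₃ T.size_pos)
  · rintro _ ⟨z, hz, rfl⟩
    exact hZ₁ z hz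
  · rintro _ ⟨z, hz, rfl⟩
    exact hZ₂ z hz
  · rw [hZ₁ z hz] at h
    exact zero_ne_one h
  · rw [hZ₂ z hz] at h
    exact one_ne_zero h
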